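/- Let $\tilde 1:\mathbb{R}\to\mathbb{C}$ be a $C^\infty$ function supported in $[-1/2,1/2]$. For a compact interval $I=[c_I-|I|/2,\,c_I+|I|/2]$ of positive length put $\tilde 1_I(\xi)=\tilde 1(|I|^{-1}(\xi-c_I))$, and let $\mathcal{F}^{-1}[g](x)=\int_{\mathbb{R}} g(\xi)e^{2\pi i x\xi}\,d\xi$. Define $$\mathcal{V}^{res}_2 f(x)=\sup_{R>0}\ \sup_{0\le\alpha<R}\ \Big(\sum_{j\in\mathbb{Z}}\big|f*\mathcal{F}^{-1}\big[\tilde 1_{[\alpha+jR,\,\alpha+(j+1)R]}\big](x)\big|^2\Big)^{1/2}\in[0,\infty].$$ Then $\mathcal{V}^{res}_2$ maps $L^p(\mathbb{R})$ boundedly into $L^p(\mathbb{R})$ for all $2<p<\infty$. That is, for every such $p$ there is a finite constant $C$, depending only on $p$ and $\tilde 1$, such that for every complex-valued $f\in L^p(\mathbb{R})$ the integrals defining the convolutions $f*\mathcal{F}^{-1}[\tilde 1_I](x)$ converge absolutely for all $I$ and all $x\in\mathbb{R}$, the function $\mathcal{V}^{res}_2 f$ is in $L^p(\mathbb{R})$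 (in particular it is measurable and finite almost everywhere), and $$\|\mathcal{V}^{res}_2 f\|_{L^p(\mathbb{R})}\le C\,\|f\|_{L^p(\mathbb{R})}.$$ -/

import Mathlib

open MeasureTheory Set
open scoped ENNReal NNReal ContDiff FourierTransform Convolution

noncomputable section

/-- The function `φ_I(x) = φ (|I|⁻¹ (x - c_I))` for the interval `I = [a, b]`,
where `c_I = (a + b) / 2` is the centre of `I` and `|I| = b - a` its length. -/
def intervalBump (φ : ℝ → ℂ) (a b : ℝ) (x : ℝ) : ℂ :=
  φ ((b - a)⁻¹ * (x - (a + b) / 2))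

/-- The convolution kernel `𝓕⁻¹[φ_I]` for `I = [a, b]`, with
`𝓕⁻¹[g](x) = ∫ g(ξ) e^{2πixξ} dξ`. -/
def intervalKernel (φ : ℝ → ℂ) (a b : ℝ) : ℝ → ℂ :=
  𝓕⁻ (intervalBump φ a b)

/-- The frequency localisation `f * 𝓕⁻¹[φ_I]` for `I = [a, b]`. -/
def freqPiece (φ f : ℝ → ℂ) (a b : ℝ) : ℝ → ℂ :=
  f ⋆[ContinuousLinearMap.mul ℂ ℂ, volume] intervalKernel φ a b

/-- The square function `(∑_{j ∈ ℤ} |f * 𝓕⁻¹[φ_{[α+jR, α+(j+1)R]}](x)|²)^{1/2}`,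
with values in `[0, ∞]`. -/
def shiftedSquareFunction (φ f : ℝ → ℂ) (R α : ℝ) (x : ℝ) : ℝ≥0∞ :=
  (∑' j : ℤ, ‖freqPiece φ f (α + j * R) (α + (j + 1) * R) x‖ₑ ^ 2) ^ (1 / 2 : ℝ)

/-- The smooth restricted 2-variation of `f`: the supremum of the shifted square functions over
all `R > 0` and `0 ≤ α < R`. -/
def restrictedVariation (φ f : ℝ → ℂ) (x : ℝ) : ℝ≥0∞ :=
  ⨆ (R : ℝ) (_ : 0 < R) (α : ℝ) (_ : α ∈ Ico 0 R), shiftedSquareFunction φ f R α x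

end

/-!
For an interval of length `R` centred at `ξ`, the substitution `t = s / R` shows that the frequency
piece of `f` at `x` is the inverse Fourier transform of `G(s) = f(x - s / R) 𝓕⁻φ(s)` at `ξ / R`.
As the interval runs through `[α + jR, α + (j + 1)R]`, the point `ξ / R` runs through a translate
of `ℤ`. Parseval on each unit interval, combined with Minkowski's inequality, therefore bounds the
square function by `∑ₙ ‖G‖_{L²(n, n + 1]}`, and the rapid decay of `𝓕⁻φ` bounds this sum by a
multiple of `M(|f|²)(x)^{1/2}`, uniformly in `R` and `α`. The Hardy–Littlewood maximal operator `M`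
is bounded on `L^{p/2}` because `p / 2 > 1`.
-/

open scoped SchwartzMap
open Metric

section MaximalFunction

variable {X : Type*} [PseudoMetricSpace X] [MeasurableSpace X] {μ : Measure X} {h : X → ℝ≥0∞}

/-- The uncentred Hardy–Littlewood maximal function of `h`: the supremum of the averages of `h`
over all open balls containing the given point. -/
noncomputable def maximalFunction (μ : Measure X) (h : X → ℝ≥0∞) (x : X) : ℝ≥0∞ :=
  ⨆ (c : X) (r : ℝ) (_ : x ∈ ball c r), ⨍⁻ y in ball c r, h y ∂μ

theorem setOf_lt_maximalFunction (μ : Measure X) (h : X → ℝ≥0∞) (t : ℝ≥0∞) :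
    {x | t < maximalFunction μ h x} =
      ⋃ a ∈ {a : X × ℝ | t < ⨍⁻ y in ball a.1 a.2, h y ∂μ}, ball a.1 a.2 := by
  ext x
  simp only [maximalFunction, lt_iSup_iff, mem_ofPred_eq, mem_iUnion, Prod.exists, exists_prop]
  grind

theorem measurable_maximalFunction [OpensMeasurableSpace X] (μ : Measure X) (h : X → ℝ≥0∞) :
    Measurable (maximalFunction μ h) := by
  refine measurable_of_Ioi fun t => IsOpen.measurableSet ?_
  change IsOpen {x | t < maximalFunction μ h x}
  rw [setOf_lt_maximalFunction]
  exact isOpen_biUnion fun _ _ => isOpen_ball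

theorem setLAverage_ball_le_maximalFunction {x c : X} {r : ℝ} (hx : x ∈ ball c r) :
    ⨍⁻ y in ball c r, h y ∂μ ≤ maximalFunction μ h x :=
  le_iSup_of_le c (le_iSup_of_le r (le_iSup_of_le hx le_rfl))

theorem maximalFunction_le_add_const {g : X → ℝ≥0∞} {t : ℝ≥0∞} (hgt : ∀ y, h y ≤ g y + t) (x : X) :
    maximalFunction μ h x ≤ maximalFunction μ g x + t := by
  refine iSup_le fun c => iSup_le fun r => iSup_le fun hx => ?_
  calc ⨍⁻ y in ball c r, h y ∂μ ≤ ⨍⁻ y in ball c r, (g y + t) ∂μ := lintegral_mono hgt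
    _ = (⨍⁻ y in ball c r, g y ∂μ) + ⨍⁻ _ in ball c r, t ∂μ :=
      lintegral_add_right _ measurable_const
    _ ≤ maximalFunction μ g x + t := by
      gcongr
      · exact setLAverage_ball_le_maximalFunction hx
      · exact (laverage_le_essSup _).trans (essSup_le_of_ae_le t (ae_of_all _ fun _ => le_rfl))

theorem maximalFunction_le_essSup (x : X) : maximalFunction μ h x ≤ essSup h μ :=
  iSup_le fun c => iSup_le fun r => iSup_le fun _ =>
    (laverage_le_essSup h).trans (essSup_mono_measure Measure.absolutelyContinuous_restrict)

end MaximalFunction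

section WeakType

variable {X : Type*} [PseudoMetricSpace X] [SecondCountableTopology X] [MeasurableSpace X]
  [OpensMeasurableSpace X] {μ : Measure X} {A : ℝ≥0} {h : X → ℝ≥0∞}

theorem mul_measure_biUnion_ball_le (hA : ∀ c r, μ (ball c (4 * r)) ≤ A * μ (ball c r))
    {t : ℝ≥0∞} {S : Set (X × ℝ)} {N : ℝ} (hpos : ∀ a ∈ S, 0 < a.2) (hN : ∀ a ∈ S, a.2 ≤ N)
    (hS : ∀ a ∈ S, t * μ (ball a.1 a.2) ≤ ∫⁻ y in ball a.1 a.2, h y ∂μ) :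
    t * μ (⋃ a ∈ S, ball a.1 a.2) ≤ A * ∫⁻ y, h y ∂μ := by
  obtain ⟨u, huS, hdisj, hcover⟩ :=
    Vitali.exists_disjoint_subfamily_covering_enlargement_ball S Prod.fst Prod.snd N hN 4
      (by norm_num)
  have hu : u.Countable := hdisj.countable_of_isOpen (fun _ _ => isOpen_ball)
    fun a ha => nonempty_ball.2 (hpos a (huS ha))
  calc t * μ (⋃ a ∈ S, ball a.1 a.2)
      ≤ t * μ (⋃ a ∈ u, ball a.1 (4 * a.2)) := by
        refine mul_le_mul_right (measure_mono (iUnion₂_subset fun a ha => ?_)) t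
        obtain ⟨b, hb, hab⟩ := hcover a ha
        exact hab.trans (subset_biUnion_of_mem (u := fun b : X × ℝ => ball b.1 (4 * b.2)) hb)
    _ ≤ t * ∑' a : u, A * μ (ball a.1.1 a.1.2) := by
        gcongr
        exact (measure_biUnion_le μ hu _).trans (ENNReal.tsum_le_tsum fun a => hA _ _)
    _ = A * ∑' a : u, t * μ (ball a.1.1 a.1.2) := by
        rw [ENNReal.tsum_mul_left, ENNReal.tsum_mul_left, mul_left_comm]
    _ ≤ A * ∑' a : u, ∫⁻ y in ball a.1.1 a.1.2, h y ∂μ := by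
        gcongr with a
        exact hS a (huS a.2)
    _ = A * ∫⁻ y in ⋃ a ∈ u, ball a.1 a.2, h y ∂μ := by
        rw [lintegral_biUnion hu (fun _ _ => measurableSet_ball) hdisj]
    _ ≤ A * ∫⁻ y, h y ∂μ := by
        gcongr
        exact Measure.restrict_le_self

theorem mul_measure_lt_maximalFunction_le
    (hA : ∀ c r, μ (ball c (4 * r)) ≤ A * μ (ball c r)) (h : X → ℝ≥0∞) (t : ℝ≥0∞) :
    t * μ {x | t < maximalFunction μ h x} ≤ A * ∫⁻ y, h y ∂μ := by
  set S : ℕ → Set (X × ℝ) := fun N => {a | t < ⨍⁻ y in ball a.1 a.2, h y ∂μ ∧ a.2 ≤ N} with hS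
  have hmono : Monotone fun N => ⋃ a ∈ S N, ball a.1 a.2 := fun M N hMN =>
    biUnion_subset_biUnion_left fun a ha => ⟨ha.1, ha.2.trans (by exact_mod_cast hMN)⟩
  have hunion : {x | t < maximalFunction μ h x} = ⋃ N, ⋃ a ∈ S N, ball a.1 a.2 := by
    rw [setOf_lt_maximalFunction]
    ext x
    simp only [hS, mem_iUnion, mem_ofPred_eq, exists_prop]
    constructor
    · rintro ⟨a, ha, hx⟩
      obtain ⟨N, hN⟩ := exists_nat_ge a.2
      exact ⟨N, a, ⟨ha, hN⟩, hx⟩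
    · rintro ⟨_, a, ha, hx⟩
      exact ⟨a, ha.1, hx⟩
  rw [hunion, hmono.measure_iUnion, ENNReal.mul_iSup]
  refine iSup_le fun N => mul_measure_biUnion_ball_le hA (N := N) ?_ (fun a ha => ha.2) ?_
  · rintro a ⟨ha, -⟩
    by_contra! hr
    simp [ball_eq_empty.2 hr] at ha
  · rintro a ⟨ha, -⟩
    rw [setLAverage_eq] at ha
    exact (ENNReal.mul_lt_of_lt_div ha).le

theorem mul_measure_lt_maximalFunction_le_setLIntegral
    (hA : ∀ c r, μ (ball c (4 * r)) ≤ A * μ (ball c r)) (h : X → ℝ≥0∞) (t : ℝ≥0∞) :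
    t * μ {x | t < maximalFunction μ h x} ≤ 2 * A * ∫⁻ y in {y | t < 2 * h y}, h y ∂μ := by
  set g : X → ℝ≥0∞ := {y | t < 2 * h y}.indicator h with hg
  have hle : ∀ y, h y ≤ g y + t / 2 := fun y => by
    by_cases hy : t < 2 * h y
    · simp [hg, hy]
    · rw [not_lt, mul_comm] at hy
      exact le_add_left (ENNReal.le_div_iff_mul_le (by simp) (by simp) |>.2 hy)
  have hsub : {x | t < maximalFunction μ h x} ⊆ {x | t / 2 < maximalFunction μ g x} := by
    intro x hx
    have hadd := maximalFunction_le_add_const (μ := μ) hle x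
    by_contra hgx
    refine hx.not_ge (hadd.trans ?_)
    calc maximalFunction μ g x + t / 2 ≤ t / 2 + t / 2 := by gcongr; exact not_lt.1 hgx
      _ = t := ENNReal.add_halves t
  calc t * μ {x | t < maximalFunction μ h x}
      ≤ 2 * (t / 2) * μ {x | t / 2 < maximalFunction μ g x} := by
        rw [ENNReal.mul_div_cancel (by simp) (by simp)]
        gcongr
    _ ≤ 2 * (A * ∫⁻ y, g y ∂μ) := by
        rw [mul_assoc]
        exact mul_le_mul_right (mul_measure_lt_maximalFunction_le hA g _) _
    _ ≤ 2 * A * ∫⁻ y in {y | t < 2 * h y}, h y ∂μ := by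
        rw [← mul_assoc]
        exact mul_le_mul_right (lintegral_indicator_le _ _) _

end WeakType

section StrongType

theorem lintegral_Ioi_ofReal_rpow (s : ℝ) :
    ∫⁻ t in Ioi (0 : ℝ), ENNReal.ofReal (t ^ s) = ⊤ := by
  by_contra hfin
  refine not_integrableOn_Ioi_rpow s ⟨by fun_prop, ?_⟩
  rw [hasFiniteIntegral_iff_ofReal]
  · exact lt_top_iff_ne_top.2 hfin
  · filter_upwards [ae_restrict_mem measurableSet_Ioi] with t ht
    exact Real.rpow_nonneg (le_of_lt ht) s

theorem lintegral_rpow_eq_lintegral_meas_ofReal_lt_mul {α : Type*} [MeasurableSpace α]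
    {μ : Measure α} {f : α → ℝ≥0∞} (hf : AEMeasurable f μ) {q : ℝ} (hq : 0 < q) :
    ∫⁻ a, f a ^ q ∂μ = ENNReal.ofReal q *
      ∫⁻ t in Ioi (0 : ℝ), μ {a | ENNReal.ofReal t < f a} * ENNReal.ofReal (t ^ (q - 1)) := by
  by_cases hfin : μ {a | f a = ⊤} = 0
  · have hae : ∀ᵐ a ∂μ, f a ≠ ⊤ := by simpa [ae_iff] using hfin
    calc ∫⁻ a, f a ^ q ∂μ = ∫⁻ a, ENNReal.ofReal ((f a).toReal ^ q) ∂μ := by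
          refine lintegral_congr_ae ?_
          filter_upwards [hae] with a ha
          rw [← ENNReal.ofReal_rpow_of_nonneg ENNReal.toReal_nonneg hq.le, ENNReal.ofReal_toReal ha]
      _ = ENNReal.ofReal q * ∫⁻ t in Ioi (0 : ℝ),
            μ {a | t < (f a).toReal} * ENNReal.ofReal (t ^ (q - 1)) :=
          lintegral_rpow_eq_lintegral_meas_lt_mul μ (ae_of_all _ fun _ => ENNReal.toReal_nonneg)
            hf.ennreal_toReal hq
      _ = _ := by
          congr 1
          refine setLIntegral_congr_fun measurableSet_Ioi fun t ht => ?_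
          congr 1
          refine measure_congr ?_
          filter_upwards [hae] with a ha
          exact propext (ENNReal.ofReal_lt_iff_lt_toReal (le_of_lt ht) ha).symm
  · have htop : ∫⁻ t in Ioi (0 : ℝ), μ {a | ENNReal.ofReal t < f a} * ENNReal.ofReal (t ^ (q - 1)) =
        ⊤ := by
      rw [← top_le_iff]
      calc ⊤ = μ {a | f a = ⊤} * ∫⁻ t in Ioi (0 : ℝ), ENNReal.ofReal (t ^ (q - 1)) := by
            rw [lintegral_Ioi_ofReal_rpow, ENNReal.mul_top hfin]
        _ = ∫⁻ t in Ioi (0 : ℝ), μ {a | f a = ⊤} * ENNReal.ofReal (t ^ (q - 1)) :=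
            (lintegral_const_mul _ (by fun_prop)).symm
        _ ≤ _ := lintegral_mono fun t => mul_le_mul_left (measure_mono fun a ha =>
            (ENNReal.ofReal_lt_top.trans_eq (Eq.symm ha) : ENNReal.ofReal t < f a)) _
    rw [htop, ENNReal.mul_top (by simpa using hq)]
    refine lintegral_eq_top_of_measure_eq_top_ne_zero (hf.pow_const q) ?_
    simpa [ENNReal.rpow_eq_top_iff_of_pos hq] using hfin

theorem lintegral_Ioi_setLIntegral_lt_mul_rpow_le {α : Type*} [MeasurableSpace α] {μ : Measure α}
    {h : α → ℝ≥0∞} (hh : AEMeasurable h μ) (c : ℝ≥0∞) {s : ℝ} (hs : 0 < s) :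
    ∫⁻ t in Ioi (0 : ℝ),
        (∫⁻ a in {a | ENNReal.ofReal t < c * h a}, h a ∂μ) * ENNReal.ofReal (t ^ (s - 1)) ≤
      c ^ s / ENNReal.ofReal s * ∫⁻ a, h a ^ (s + 1) ∂μ := by
  have hs0 : ENNReal.ofReal s ≠ 0 := by simpa using hs
  set ν := μ.withDensity h with hν
  have hdensity : ∫⁻ a, (c * h a) ^ s ∂ν = c ^ s * ∫⁻ a, h a ^ (s + 1) ∂μ := by
    rw [hν, lintegral_withDensity_eq_lintegral_mul₀ hh (by fun_prop),
      ← lintegral_const_mul'' _ (by fun_prop)]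
    refine lintegral_congr fun a => ?_
    rw [Pi.mul_apply, ENNReal.mul_rpow_of_nonneg _ _ hs.le, mul_left_comm, mul_comm (h a),
      ENNReal.rpow_add_of_nonneg _ _ hs.le zero_le_one, ENNReal.rpow_one]
  have hlayer := lintegral_rpow_eq_lintegral_meas_ofReal_lt_mul (μ := ν)
    (AEMeasurable.mono_ac (hh.const_mul c) (withDensity_absolutelyContinuous _ _)) hs
  calc _ ≤ ∫⁻ t in Ioi (0 : ℝ),
          ν {a | ENNReal.ofReal t < c * h a} * ENNReal.ofReal (t ^ (s - 1)) :=
        lintegral_mono fun t => mul_le_mul_left (withDensity_apply_le _ _) _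
    _ = (ENNReal.ofReal s)⁻¹ * ∫⁻ a, (c * h a) ^ s ∂ν := by
        rw [hlayer, ENNReal.inv_mul_cancel_left hs0 ENNReal.ofReal_ne_top]
    _ = c ^ s / ENNReal.ofReal s * ∫⁻ a, h a ^ (s + 1) ∂μ := by
        rw [hdensity, ← mul_assoc, div_eq_mul_inv, mul_comm (c ^ s)]

variable {X : Type*} [PseudoMetricSpace X] [SecondCountableTopology X] [MeasurableSpace X]
  [OpensMeasurableSpace X] {μ : Measure X} {A : ℝ≥0} {h : X → ℝ≥0∞}

theorem lintegral_maximalFunction_rpow_le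
    (hA : ∀ c r, μ (ball c (4 * r)) ≤ A * μ (ball c r)) (hh : AEMeasurable h μ) {s : ℝ}
    (hs : 0 < s) :
    ∫⁻ x, maximalFunction μ h x ^ (s + 1) ∂μ ≤
      ENNReal.ofReal (s + 1) * (2 * A * (2 ^ s / ENNReal.ofReal s)) *
        ∫⁻ x, h x ^ (s + 1) ∂μ := by
  have hweak : ∀ t ∈ Ioi (0 : ℝ),
      μ {x | ENNReal.ofReal t < maximalFunction μ h x} * ENNReal.ofReal (t ^ s) ≤
        2 * A * ((∫⁻ x in {x | ENNReal.ofReal t < 2 * h x}, h x ∂μ) *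
          ENNReal.ofReal (t ^ (s - 1))) := by
    intro t (ht : 0 < t)
    have hsplit : ENNReal.ofReal (t ^ s) = ENNReal.ofReal t * ENNReal.ofReal (t ^ (s - 1)) := by
      rw [← ENNReal.ofReal_mul ht.le, Real.rpow_sub_one ht.ne', mul_div_cancel₀ _ ht.ne']
    rw [hsplit, ← mul_assoc, ← mul_assoc, mul_comm (μ _)]
    exact mul_le_mul_left (mul_measure_lt_maximalFunction_le_setLIntegral hA h _) _
  calc ∫⁻ x, maximalFunction μ h x ^ (s + 1) ∂μ
      = ENNReal.ofReal (s + 1) * ∫⁻ t in Ioi (0 : ℝ),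
          μ {x | ENNReal.ofReal t < maximalFunction μ h x} * ENNReal.ofReal (t ^ s) := by
        rw [lintegral_rpow_eq_lintegral_meas_ofReal_lt_mul
          (measurable_maximalFunction μ h).aemeasurable (by positivity), add_sub_cancel_right]
    _ ≤ ENNReal.ofReal (s + 1) * (2 * A * ∫⁻ t in Ioi (0 : ℝ),
          (∫⁻ x in {x | ENNReal.ofReal t < 2 * h x}, h x ∂μ) * ENNReal.ofReal (t ^ (s - 1))) := by
        rw [← lintegral_const_mul' (2 * A : ℝ≥0∞) _ (by finiteness)]
        exact mul_le_mul_right (setLIntegral_mono' measurableSet_Ioi hweak) _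
    _ ≤ ENNReal.ofReal (s + 1) * (2 * A * (2 ^ s / ENNReal.ofReal s *
          ∫⁻ x, h x ^ (s + 1) ∂μ)) := by
        gcongr
        exact lintegral_Ioi_setLIntegral_lt_mul_rpow_le hh 2 hs
    _ = _ := by simp only [mul_assoc]

theorem exists_eLpNorm_maximalFunction_le
    (hA : ∀ c r, μ (ball c (4 * r)) ≤ A * μ (ball c r)) {q : ℝ≥0∞} (hq : 1 < q) :
    ∃ C : ℝ≥0, ∀ h : X → ℝ≥0∞, AEMeasurable h μ →
      eLpNorm (maximalFunction μ h) q μ ≤ C * eLpNorm h q μ := by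
  rcases eq_or_ne q ⊤ with rfl | hq_top
  · refine ⟨1, fun h _ => ?_⟩
    rw [ENNReal.coe_one, one_mul, eLpNorm_exponent_top, eLpNorm_exponent_top]
    exact eLpNormEssSup_le_of_ae_enorm_bound (ae_of_all _ maximalFunction_le_essSup)
  set s : ℝ := q.toReal - 1 with hs_def
  have hs : 0 < s := sub_pos.2 (by simpa using (ENNReal.toReal_lt_toReal (by simp) hq_top).2 hq)
  have hqs : q.toReal = s + 1 := by simp [hs_def]
  set B := ENNReal.ofReal (s + 1) * (2 * A * (2 ^ s / ENNReal.ofReal s))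
  have hs0 : ENNReal.ofReal s ≠ 0 := by simpa using hs
  have hB_top : B ^ (1 / (s + 1)) ≠ ⊤ := by finiteness
  refine ⟨(B ^ (1 / (s + 1))).toNNReal, fun h hh => ?_⟩
  have hq0 : q ≠ 0 := (zero_lt_one.trans hq).ne'
  rw [ENNReal.coe_toNNReal hB_top, eLpNorm_eq_lintegral_rpow_enorm_toReal hq0 hq_top,
    eLpNorm_eq_lintegral_rpow_enorm_toReal hq0 hq_top, hqs,
    ← ENNReal.mul_rpow_of_nonneg _ _ (by positivity)]
  exact ENNReal.rpow_le_rpow (lintegral_maximalFunction_rpow_le hA hh hs) (by positivity)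

theorem exists_eLpNorm_maximalFunction_enorm_rpow_le {F : Type*} [NormedAddCommGroup F]
    (hA : ∀ c r, μ (ball c (4 * r)) ≤ A * μ (ball c r)) {r : ℝ} (hr : 0 < r) {p : ℝ≥0∞}
    (hrp : ENNReal.ofReal r < p) :
    ∃ C : ℝ≥0, ∀ f : X → F, AEStronglyMeasurable f μ →
      eLpNorm (fun x => maximalFunction μ (fun y => ‖f y‖ₑ ^ r) x ^ (1 / r)) p μ ≤
        C * eLpNorm f p μ := by
  have hr' : ENNReal.ofReal r ≠ 0 := by simpa using hr
  have hq : 1 < p / ENNReal.ofReal r := by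
    rwa [ENNReal.lt_div_iff_mul_lt (.inl hr') (.inl ENNReal.ofReal_ne_top), one_mul]
  obtain ⟨C, hC⟩ := exists_eLpNorm_maximalFunction_le hA hq
  refine ⟨C ^ (1 / r), fun f hf => ?_⟩
  have hp_div : p * ENNReal.ofReal (1 / r) = p / ENNReal.ofReal r := by
    rw [one_div, ENNReal.ofReal_inv_of_pos hr, div_eq_mul_inv]
  calc eLpNorm (fun x => maximalFunction μ (fun y => ‖f y‖ₑ ^ r) x ^ (1 / r)) p μ
      = eLpNorm (maximalFunction μ fun y => ‖f y‖ₑ ^ r) (p / ENNReal.ofReal r) μ ^ (1 / r) := by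
        rw [← hp_div, ← eLpNorm_enorm_rpow _ (one_div_pos.2 hr)]
        simp only [enorm_eq_self]
    _ ≤ (C * eLpNorm (fun y => ‖f y‖ₑ ^ r) (p / ENNReal.ofReal r) μ) ^ (1 / r) := by
        gcongr
        exact hC _ (hf.enorm.pow_const r)
    _ = (C ^ (1 / r) : ℝ≥0) * eLpNorm f p μ := by
        rw [eLpNorm_enorm_rpow f hr, ENNReal.div_mul_cancel hr' ENNReal.ofReal_ne_top,
          ENNReal.mul_rpow_of_nonneg _ _ (by positivity), ← ENNReal.rpow_mul,
          mul_one_div_cancel hr.ne', ENNReal.rpow_one, ENNReal.coe_rpow_of_nonneg _ (by positivity)]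

end StrongType

section AddHaar

variable {E : Type*} [NormedAddCommGroup E] [NormedSpace ℝ E] [MeasurableSpace E] [BorelSpace E]
  [FiniteDimensional ℝ E] (μ : Measure E) [μ.IsAddHaarMeasure]

theorem addHaar_ball_mul_le (x : E) {c : ℝ} (hc : 0 < c) (r : ℝ) :
    μ (ball x (c * r)) ≤ (c ^ Module.finrank ℝ E).toNNReal * μ (ball x r) := by
  rw [Measure.addHaar_ball_mul_of_pos μ x hc, Measure.addHaar_ball_center μ x r]
  rfl

theorem setLAverage_ball_comp_add_smul (h : E → ℝ≥0∞) (x : E) {c : ℝ} (hc : c ≠ 0) (ρ : ℝ) :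
    ⨍⁻ s in ball 0 ρ, h (x + c • s) ∂μ = ⨍⁻ y in ball x (|c| * ρ), h y ∂μ := by
  set k := ENNReal.ofReal |(c ^ Module.finrank ℝ E)⁻¹| with hk_def
  have hk : k ≠ 0 := by simp [hk_def, hc]
  have hT : MeasurePreserving (fun s => x + c • s) μ (k • μ) :=
    (measurePreserving_add_left (k • μ) x).comp
      ⟨measurable_const_smul c, Measure.map_addHaar_smul μ hc⟩
  have hTe : MeasurableEmbedding fun s => x + c • s :=
    (measurableEmbedding_addLeft x).comp (measurableEmbedding_const_smul₀ hc)
  have hball : (fun s => x + c • s) ⁻¹' ball x (|c| * ρ) = ball 0 ρ := by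
    ext s
    simp [dist_eq_norm, norm_smul, hc]
  rw [setLAverage_eq, setLAverage_eq, ← hball, hT.setLIntegral_comp_preimage_emb hTe,
    hT.measure_preimage_emb hTe, Measure.restrict_smul, lintegral_smul_measure, Measure.smul_apply,
    smul_eq_mul, smul_eq_mul, ENNReal.mul_div_mul_left _ _ hk ENNReal.ofReal_ne_top]

theorem setLIntegral_ball_comp_add_smul_le (h : E → ℝ≥0∞) (x : E) {c ρ : ℝ} (hc : c ≠ 0)
    (hρ : 0 < ρ) :
    ∫⁻ s in ball 0 ρ, h (x + c • s) ∂μ ≤ μ (ball 0 ρ) * maximalFunction μ h x := by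
  rw [← measure_mul_setLAverage _ measure_ball_lt_top.ne, setLAverage_ball_comp_add_smul μ h x hc]
  gcongr
  exact setLAverage_ball_le_maximalFunction (mem_ball_self (by positivity))

end AddHaar

section Minkowski

theorem tsum_tsum_rpow_le {ι κ : Type*} (a : ι → κ → ℝ≥0∞) {q : ℝ} (hq : 1 ≤ q) :
    (∑' k, (∑' i, a i k) ^ q) ^ (1 / q) ≤ ∑' i, (∑' k, a i k ^ q) ^ (1 / q) := by
  have hq0 : 0 < q := zero_lt_one.trans_le hq
  have hfinite : ∀ (s : Finset κ) (u : Finset ι),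
      (∑ k ∈ s, (∑ i ∈ u, a i k) ^ q) ^ (1 / q) ≤ ∑' i, (∑' k, a i k ^ q) ^ (1 / q) := by
    intro s u
    have := Finset.le_sum_of_subadditive (fun v : κ → ℝ≥0∞ => (∑ k ∈ s, v k ^ q) ^ (1 / q))
      (by simp [hq0]) (fun v w => ENNReal.Lp_add_le s v w hq) u a
    simp only [Finset.sum_apply] at this
    refine this.trans ((Finset.sum_le_sum fun i _ => ?_).trans (ENNReal.sum_le_tsum u))
    gcongr
    exact ENNReal.sum_le_tsum s
  rw [one_div, ENNReal.rpow_inv_le_iff hq0, ENNReal.tsum_eq_iSup_sum]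
  refine iSup_le fun s => ?_
  have hlim : Filter.Tendsto (fun u : Finset ι => ∑ k ∈ s, (∑ i ∈ u, a i k) ^ q) Filter.atTop
      (nhds (∑ k ∈ s, (∑' i, a i k) ^ q)) :=
    tendsto_finsetSum _ fun k _ =>
      ((ENNReal.continuous_rpow_const.tendsto _).comp ENNReal.summable.hasSum)
  refine le_of_tendsto' hlim fun u => ?_
  rw [← ENNReal.rpow_inv_le_iff hq0, ← one_div]
  exact hfinite s u

end Minkowski

section Periodization

variable {G : ℝ → ℂ}

theorem tsum_sq_enorm_fourierInv_indicator_Ioc {a : ℝ}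
    (hG : MemLp G 2 (volume.restrict (Ioc a (a + 1)))) (β : ℝ) :
    ∑' j : ℤ, ‖𝓕⁻ ((Ioc a (a + 1)).indicator G) (β + j)‖ₑ ^ 2 =
      ∫⁻ s in Ioc a (a + 1), ‖G s‖ₑ ^ 2 := by
  have hlt : a < a + 1 := lt_add_one a
  set H : ℝ → ℂ := fun s => Complex.exp ((2 * Real.pi * (s * β) : ℝ) * Complex.I) * G s with hH
  have hHnorm : ∀ s, ‖H s‖ = ‖G s‖ := fun s => by
    rw [hH, norm_mul, Complex.norm_exp_ofReal_mul_I, one_mul]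
  have hHL2 : MemLp H 2 (volume.restrict (Ioc a (a + 1))) :=
    (memLp_congr_norm (.mul (by fun_prop) hG.1) hG.1 (ae_of_all _ hHnorm)).2 hG
  have hcoeff : ∀ j : ℤ, fourierCoeffOn hlt H (-j) =
      𝓕⁻ ((Ioc a (a + 1)).indicator G) (β + j) := fun j => by
    rw [Real.fourierInv_eq', fourierCoeffOn_eq_integral, intervalIntegral.integral_of_le hlt.le,
      add_sub_cancel_left, div_one, one_smul, ← integral_indicator measurableSet_Ioc]
    refine integral_congr_ae (ae_of_all _ fun s => ?_)
    by_cases hs : s ∈ Ioc a (a + 1)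
    · simp only [indicator_of_mem hs, fourier_coe_apply, smul_eq_mul, hH, ← mul_assoc,
        ← Complex.exp_add, RCLike.inner_apply, conj_trivial]
      congr 2
      push_cast
      ring
    · simp [hs]
  have hsum := (Equiv.neg ℤ).hasSum_iff.2 (hasSum_sq_fourierCoeffOn hlt hHL2)
  simp only [Function.comp_def, Equiv.neg_apply, hcoeff, hHnorm, add_sub_cancel_left, inv_one,
    one_smul, intervalIntegral.integral_of_le hlt.le] at hsum
  calc ∑' j : ℤ, ‖𝓕⁻ ((Ioc a (a + 1)).indicator G) (β + j)‖ₑ ^ 2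
      = ENNReal.ofReal (∑' j : ℤ, ‖𝓕⁻ ((Ioc a (a + 1)).indicator G) (β + j)‖ ^ 2) := by
        rw [ENNReal.ofReal_tsum_of_nonneg (fun _ => by positivity) hsum.summable]
        simp only [ENNReal.ofReal_pow (norm_nonneg _), ofReal_norm]
    _ = ∫⁻ s in Ioc a (a + 1), ‖G s‖ₑ ^ 2 := by
        rw [hsum.tsum_eq, ofReal_integral_eq_lintegral_ofReal hG.norm.integrable_sq
          (ae_of_all _ fun _ => by positivity)]
        simp only [ENNReal.ofReal_pow (norm_nonneg _), ofReal_norm]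

theorem integrable_of_tsum_eLpNorm_Ioc_ne_top (hG : AEStronglyMeasurable G volume) {p : ℝ≥0∞}
    (hp : 1 ≤ p) (hfin : ∑' n : ℤ, eLpNorm G p (volume.restrict (Ioc (n : ℝ) (n + 1))) ≠ ⊤) :
    Integrable G := by
  refine ⟨hG, ?_⟩
  rw [HasFiniteIntegral, ← setLIntegral_univ, ← iUnion_Ioc_intCast,
    lintegral_iUnion (fun _ => measurableSet_Ioc) (pairwise_disjoint_Ioc_intCast ℝ)]
  refine (ENNReal.tsum_le_tsum fun n => ?_).trans_lt (lt_top_iff_ne_top.2 hfin)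
  rw [← eLpNorm_one_eq_lintegral_enorm]
  have : IsProbabilityMeasure (volume.restrict (Ioc (n : ℝ) (n + 1))) := ⟨by simp⟩
  exact eLpNorm_le_eLpNorm_of_exponent_le hp hG.restrict

theorem enorm_fourierInv_le_tsum_indicator_Ioc (hG : Integrable G) (w : ℝ) :
    ‖𝓕⁻ G w‖ₑ ≤ ∑' n : ℤ, ‖𝓕⁻ ((Ioc (n : ℝ) (n + 1)).indicator G) w‖ₑ := by
  have hexp : Integrable fun s =>
      Complex.exp ((2 * Real.pi * inner ℝ s w : ℝ) * Complex.I) • G s :=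
    hG.bdd_mul (c := 1) (by fun_prop)
      (ae_of_all _ fun s => (Complex.norm_exp_ofReal_mul_I _).le)
  have hsum := hasSum_integral_iUnion
    (fun n : ℤ => measurableSet_Ioc (a := (n : ℝ)) (b := n + 1))
    (pairwise_disjoint_Ioc_intCast ℝ) hexp.integrableOn
  simp only [iUnion_Ioc_intCast, setIntegral_univ, ← integral_indicator measurableSet_Ioc,
    indicator_smul, ← Real.fourierInv_eq'] at hsum
  rw [← hsum.tsum_eq]
  exact enorm_tsum_le_tsum_enorm

theorem rpow_tsum_sq_enorm_fourierInv_le (hG : AEStronglyMeasurable G volume) (β : ℝ) :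
    (∑' j : ℤ, ‖𝓕⁻ G (β + j)‖ₑ ^ 2) ^ (1 / 2 : ℝ) ≤
      ∑' n : ℤ, eLpNorm G 2 (volume.restrict (Ioc (n : ℝ) (n + 1))) := by
  by_cases htop : ∑' n : ℤ, eLpNorm G 2 (volume.restrict (Ioc (n : ℝ) (n + 1))) = ⊤
  · exact htop ▸ le_top
  have hL2 : ∀ n : ℤ, MemLp G 2 (volume.restrict (Ioc (n : ℝ) (n + 1))) := fun n =>
    ⟨hG.restrict, (ENNReal.ne_top_of_tsum_ne_top htop n).lt_top⟩
  have hsplit := enorm_fourierInv_le_tsum_indicator_Ioc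
    (integrable_of_tsum_eLpNorm_Ioc_ne_top hG one_le_two htop)
  calc (∑' j : ℤ, ‖𝓕⁻ G (β + j)‖ₑ ^ 2) ^ (1 / 2 : ℝ)
      ≤ (∑' j : ℤ, (∑' n : ℤ, ‖𝓕⁻ ((Ioc (n : ℝ) (n + 1)).indicator G) (β + j)‖ₑ) ^ (2 : ℝ)) ^
          (1 / 2 : ℝ) := by
        simp only [ENNReal.rpow_two]
        gcongr with j
        exact hsplit _
    _ ≤ ∑' n : ℤ, (∑' j : ℤ, ‖𝓕⁻ ((Ioc (n : ℝ) (n + 1)).indicator G) (β + j)‖ₑ ^ (2 : ℝ)) ^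
          (1 / 2 : ℝ) := tsum_tsum_rpow_le _ one_le_two
    _ = ∑' n : ℤ, eLpNorm G 2 (volume.restrict (Ioc (n : ℝ) (n + 1))) := by
        refine tsum_congr fun n => ?_
        rw [eLpNorm_eq_lintegral_rpow_enorm_toReal two_ne_zero ENNReal.ofNat_ne_top]
        simp only [ENNReal.rpow_two, ENNReal.toReal_ofNat,
          tsum_sq_enorm_fourierInv_indicator_Ioc (hL2 n)]

end Periodization

section SchwartzConvolution

variable {E F' : Type*} [NormedAddCommGroup E] [NormedAddCommGroup F'] [NormedSpace ℝ F']

theorem one_add_norm_rpow_neg_le {u v : E} (huv : ‖u - v‖ ≤ 1) (k : ℕ) :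
    (1 + ‖u‖) ^ (-k : ℝ) ≤ 2 ^ k * (1 + ‖v‖) ^ (-k : ℝ) := by
  have hv : (1 + ‖v‖) / 2 ≤ 1 + ‖u‖ := by
    rw [← norm_neg, neg_sub] at huv
    linarith [norm_le_norm_add_norm_sub' v u, norm_nonneg u]
  calc (1 + ‖u‖) ^ (-k : ℝ) ≤ ((1 + ‖v‖) / 2) ^ (-k : ℝ) :=
        Real.rpow_le_rpow_of_nonpos (by positivity) hv (by simp)
    _ = 2 ^ k * (1 + ‖v‖) ^ (-k : ℝ) := by
        rw [Real.div_rpow (by positivity) two_pos.le, Real.rpow_neg two_pos.le, Real.rpow_natCast,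
          div_inv_eq_mul, mul_comm]

variable [NormedSpace ℝ E]

theorem exists_norm_schwartzMap_le (ψ : 𝓢(E, F')) (k : ℕ) :
    ∃ D : ℝ, 0 ≤ D ∧ ∀ x, ‖ψ x‖ ≤ D * (1 + ‖x‖) ^ (-k : ℝ) := by
  refine ⟨2 ^ k * (Finset.Iic (k, 0)).sup (fun m => SchwartzMap.seminorm ℝ m.1 m.2) ψ,
    by positivity, fun x => ?_⟩
  have h := SchwartzMap.one_add_le_sup_seminorm_apply (𝕜 := ℝ) (m := (k, 0)) le_rfl le_rfl ψ x
  rw [norm_iteratedFDeriv_zero] at h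
  rwa [Real.rpow_neg (by positivity), Real.rpow_natCast, ← div_eq_mul_inv,
    le_div_iff₀' (by positivity)]

variable [MeasurableSpace E] [BorelSpace E] [FiniteDimensional ℝ E]
  {μ : Measure E} [μ.IsAddHaarMeasure]
  {𝕜 F F'' : Type*} [NontriviallyNormedField 𝕜] [NormedSpace 𝕜 F']
  [NormedAddCommGroup F] [NormedSpace 𝕜 F] [NormedAddCommGroup F''] [NormedSpace 𝕜 F'']
  {f : E → F} {p : ℝ≥0∞}

theorem convolutionExists_schwartzMap (hf : MemLp f p μ) (hp : 1 ≤ p) (ψ : 𝓢(E, F'))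
    (L : F →L[𝕜] F' →L[𝕜] F'') : ConvolutionExists f ψ L μ := by
  intro x
  have := ENNReal.HolderConjugate.conjExponent hp
  exact memLp_one_iff_integrable.1 <| L.memLp_of_bilin 1 hf <|
    (ψ.memLp p.conjExponent μ).comp_measurePreserving (μ.measurePreserving_sub_left x)

theorem continuous_convolution_schwartzMap [NormedSpace ℝ F''] (hf : MemLp f p μ) (hp : 1 ≤ p)
    (ψ : 𝓢(E, F')) (L : F →L[𝕜] F' →L[𝕜] F'') : Continuous (f ⋆[L, μ] ψ) := by
  have := ENNReal.HolderConjugate.conjExponent hp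
  obtain ⟨k, hk⟩ :=
    Measure.HasTemperateGrowth.exists_eLpNorm_lt_top p.conjExponent (μ := μ) inferInstance
  obtain ⟨D, hD, hψ⟩ := exists_norm_schwartzMap_le ψ k
  have hdecay : MemLp (fun t : E => (1 + ‖t‖) ^ (-k : ℝ)) p.conjExponent μ :=
    ⟨(Continuous.rpow_const (by fun_prop) fun t => .inl (by positivity)).aestronglyMeasurable, hk⟩
  have hint (x₀ : E) : Integrable (fun t => ‖f t‖ * (1 + ‖x₀ - t‖) ^ (-k : ℝ)) μ :=
    hf.norm.integrable_mul (hdecay.comp_measurePreserving (μ.measurePreserving_sub_left x₀))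
  refine continuous_iff_continuousAt.2 fun x₀ => continuousAt_of_dominated
    (bound := fun t => ‖L‖ * D * 2 ^ k * (‖f t‖ * (1 + ‖x₀ - t‖) ^ (-k : ℝ)))
    (.of_forall fun x => (convolutionExists_schwartzMap hf hp ψ L x).1) ?_
    ((hint x₀).const_mul _) (ae_of_all _ fun t => by fun_prop)
  filter_upwards [ball_mem_nhds x₀ one_pos] with x hx
  refine ae_of_all _ fun t => ?_
  have hshift : ‖(x - t) - (x₀ - t)‖ ≤ 1 := by
    rw [sub_sub_sub_cancel_right, ← dist_eq_norm]
    exact (mem_ball.1 hx).le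
  calc ‖L (f t) (ψ (x - t))‖ ≤ ‖L‖ * ‖f t‖ * ‖ψ (x - t)‖ := L.le_opNorm₂ _ _
    _ ≤ ‖L‖ * ‖f t‖ * (D * (2 ^ k * (1 + ‖x₀ - t‖) ^ (-k : ℝ))) := by
      gcongr
      exact (hψ _).trans (by gcongr; exact one_add_norm_rpow_neg_le hshift k)
    _ = ‖L‖ * D * 2 ^ k * (‖f t‖ * (1 + ‖x₀ - t‖) ^ (-k : ℝ)) := by ring

end SchwartzConvolution

section FrequencyLocalization

variable {a b : ℝ}

theorem exists_schwartzMap_coe_eq_intervalKernel (φ : 𝓢(ℝ, ℂ)) (hab : a < b) :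
    ∃ ψ : 𝓢(ℝ, ℂ), ⇑ψ = intervalKernel φ a b := by
  let dilation : ℝ ≃L[ℝ] ℝ := ContinuousLinearEquiv.unitsEquivAut ℝ
    (Units.mk0 (b - a)⁻¹ (inv_pos.2 (sub_pos.2 hab)).ne')
  refine ⟨𝓕⁻ ((SchwartzMap.compCLMOfContinuousLinearEquiv ℝ dilation φ).compSubConstCLM ℝ
    ((a + b) / 2)), ?_⟩
  rw [SchwartzMap.fourierInv_coe, intervalKernel]
  congr 1
  ext x
  simp [intervalBump, dilation, mul_comm]

variable (φ f : ℝ → ℂ)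

theorem intervalKernel_apply (hab : a < b) (u : ℝ) :
    intervalKernel φ a b u = (b - a : ℝ) *
      (Complex.exp ((2 * Real.pi * ((a + b) / 2 * u) : ℝ) * Complex.I) *
        𝓕⁻ φ ((b - a) * u)) := by
  have hR : 0 < b - a := sub_pos.2 hab
  set G : ℝ → ℂ := fun w =>
    Complex.exp ((2 * Real.pi * inner ℝ w ((b - a) * u) : ℝ) * Complex.I) • φ w with hG
  have hphase : ∀ v : ℝ, Complex.exp ((2 * Real.pi * inner ℝ v u : ℝ) * Complex.I) •
      intervalBump φ a b v =
      Complex.exp ((2 * Real.pi * ((a + b) / 2 * u) : ℝ) * Complex.I) *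
        G ((b - a)⁻¹ * (v - (a + b) / 2)) := by
    intro v
    simp only [hG, intervalBump, smul_eq_mul, ← mul_assoc, ← Complex.exp_add]
    congr 2
    rw [← add_mul, ← Complex.ofReal_add]
    congr 2
    simp only [RCLike.inner_apply, conj_trivial]
    field_simp
    ring
  simp only [intervalKernel, Real.fourierInv_eq', hphase]
  rw [integral_const_mul, integral_sub_right_eq_self (fun v => G ((b - a)⁻¹ * v)),
    Measure.integral_comp_mul_left, inv_inv, abs_of_pos hR, Complex.real_smul]
  ring

theorem freqPiece_apply (hab : a < b) (x : ℝ) :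
    freqPiece φ f a b x =
      𝓕⁻ (fun s => f (x + (-(b - a)⁻¹) • s) * 𝓕⁻ φ s) ((a + b) / 2 / (b - a)) := by
  have hR : 0 < b - a := sub_pos.2 hab
  set H : ℝ → ℂ := fun s =>
    Complex.exp ((2 * Real.pi * inner ℝ s ((a + b) / 2 / (b - a)) : ℝ) * Complex.I) •
      (f (x + (-(b - a)⁻¹) • s) * 𝓕⁻ φ s) with hH
  have hintegrand : ∀ t, f (x - t) * intervalKernel φ a b t = (b - a : ℝ) * H ((b - a) * t) := by
    intro t
    rw [intervalKernel_apply φ hab, hH]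
    simp only [RCLike.inner_apply, conj_trivial, smul_eq_mul, neg_mul,
      inv_mul_cancel_left₀ hR.ne', ← sub_eq_add_neg]
    rw [show (a + b) / 2 / (b - a) * ((b - a) * t) = (a + b) / 2 * t by field_simp]
    ring
  rw [freqPiece, convolution_mul_swap, Real.fourierInv_eq']
  simp only [hintegrand]
  rw [integral_const_mul, Measure.integral_comp_mul_left, abs_of_pos (inv_pos.2 hR),
    Complex.real_smul, ← mul_assoc, ← Complex.ofReal_mul, mul_inv_cancel₀ hR.ne',
    Complex.ofReal_one, one_mul]

end FrequencyLocalization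

section PointwiseBound

theorem tsum_ofReal_one_add_norm_rpow_neg_two_ne_top :
    ∑' n : ℤ, ENNReal.ofReal ((1 + ‖(n : ℝ)‖) ^ (-2 : ℝ)) ≠ ⊤ := by
  refine Summable.tsum_ofReal_ne_top ?_
  have h : Summable fun n : ℕ => (1 + ‖(n : ℝ)‖) ^ (-2 : ℝ) := by
    have hshift := (summable_nat_add_iff 1).2
      (Real.summable_nat_rpow.2 (by norm_num : (-2 : ℝ) < -1))
    exact hshift.congr fun n => by simp [add_comm]
  exact .of_nat_of_neg (by simpa using h) (by simpa using h)

theorem eLpNorm_two_comp_add_smul_Ioc_le (f : ℝ → ℂ) (x : ℝ) {c : ℝ} (hc : c ≠ 0) (n : ℤ) :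
    eLpNorm (fun s => f (x + c • s)) 2 (volume.restrict (Ioc (n : ℝ) (n + 1))) ≤
      ENNReal.ofReal (2 * (1 + ‖(n : ℝ)‖)) *
        maximalFunction volume (fun y => ‖f y‖ₑ ^ (2 : ℝ)) x ^ (1 / 2 : ℝ) := by
  set N : ℝ := 1 + ‖(n : ℝ)‖ with hN
  have hN1 : 1 ≤ N := by simp [hN]
  have hsub : Ioc (n : ℝ) (n + 1) ⊆ ball 0 (N + 1) := fun s hs => by
    rw [mem_ball_zero_iff, Real.norm_eq_abs, abs_lt]
    rw [Real.norm_eq_abs] at hN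
    constructor <;> linarith [hs.1, hs.2, neg_abs_le (n : ℝ), le_abs_self (n : ℝ)]
  rw [eLpNorm_eq_lintegral_rpow_enorm_toReal two_ne_zero ENNReal.ofNat_ne_top,
    ENNReal.toReal_ofNat]
  calc (∫⁻ s in Ioc (n : ℝ) (n + 1), ‖f (x + c • s)‖ₑ ^ (2 : ℝ)) ^ (1 / 2 : ℝ)
      ≤ (volume (ball (0 : ℝ) (N + 1)) *
          maximalFunction volume (fun y => ‖f y‖ₑ ^ (2 : ℝ)) x) ^ (1 / 2 : ℝ) := by
        refine ENNReal.rpow_le_rpow ((lintegral_mono_set hsub).trans ?_) (by positivity)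
        exact setLIntegral_ball_comp_add_smul_le volume _ x hc (by positivity)
    _ ≤ (ENNReal.ofReal (2 * N) ^ (2 : ℝ) *
          maximalFunction volume (fun y => ‖f y‖ₑ ^ (2 : ℝ)) x) ^ (1 / 2 : ℝ) := by
        gcongr
        rw [Real.volume_ball, ENNReal.ofReal_rpow_of_nonneg (by positivity) two_pos.le,
          Real.rpow_two]
        exact ENNReal.ofReal_le_ofReal (by nlinarith)
    _ = _ := by
        rw [ENNReal.mul_rpow_of_nonneg _ _ (by positivity), ← ENNReal.rpow_mul,
          mul_one_div_cancel two_ne_zero, ENNReal.rpow_one]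

theorem eLpNorm_two_comp_add_smul_mul_Ioc_le (f : ℝ → ℂ) {ψ : ℝ → ℂ} {D : ℝ} (hD : 0 ≤ D)
    (hψ : ∀ s, ‖ψ s‖ ≤ D * (1 + ‖s‖) ^ (-(3 : ℕ) : ℝ)) (x : ℝ) {c : ℝ} (hc : c ≠ 0) (n : ℤ) :
    eLpNorm (fun s => f (x + c • s) * ψ s) 2 (volume.restrict (Ioc (n : ℝ) (n + 1))) ≤
      ENNReal.ofReal (16 * D) * ENNReal.ofReal ((1 + ‖(n : ℝ)‖) ^ (-2 : ℝ)) *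
        maximalFunction volume (fun y => ‖f y‖ₑ ^ (2 : ℝ)) x ^ (1 / 2 : ℝ) := by
  set N : ℝ := 1 + ‖(n : ℝ)‖
  have hN0 : 0 < N := by positivity
  have hdecay : ∀ s ∈ Ioc (n : ℝ) (n + 1),
      ‖f (x + c • s) * ψ s‖ ≤ 8 * D * N ^ (-3 : ℝ) * ‖f (x + c • s)‖ := fun s hs => by
    have hsn : ‖s - n‖ ≤ 1 := by
      rw [Real.norm_eq_abs, abs_le]
      constructor <;> linarith [hs.1, hs.2]
    rw [norm_mul, mul_comm]
    gcongr
    calc ‖ψ s‖ ≤ D * (2 ^ 3 * N ^ (-(3 : ℕ) : ℝ)) :=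
          (hψ s).trans (by gcongr; exact one_add_norm_rpow_neg_le hsn 3)
      _ = 8 * D * N ^ (-3 : ℝ) := by push_cast; ring
  calc eLpNorm (fun s => f (x + c • s) * ψ s) 2 (volume.restrict (Ioc (n : ℝ) (n + 1)))
      ≤ ENNReal.ofReal (8 * D * N ^ (-3 : ℝ)) *
          eLpNorm (fun s => f (x + c • s)) 2 (volume.restrict (Ioc (n : ℝ) (n + 1))) :=
        eLpNorm_le_mul_eLpNorm_of_ae_le_mul (ae_restrict_of_forall_mem measurableSet_Ioc hdecay) 2
    _ ≤ ENNReal.ofReal (8 * D * N ^ (-3 : ℝ)) * (ENNReal.ofReal (2 * N) *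
          maximalFunction volume (fun y => ‖f y‖ₑ ^ (2 : ℝ)) x ^ (1 / 2 : ℝ)) := by
        gcongr
        exact eLpNorm_two_comp_add_smul_Ioc_le f x hc n
    _ = _ := by
        rw [← mul_assoc, ← ENNReal.ofReal_mul (by positivity), ← ENNReal.ofReal_mul (by positivity),
          show (-2 : ℝ) = -3 + 1 by norm_num, Real.rpow_add_one hN0.ne']
        ring_nf

theorem shiftedSquareFunction_le {φ f : ℝ → ℂ} (hφ : Continuous (𝓕⁻ φ)) {D : ℝ} (hD : 0 ≤ D)
    (hφD : ∀ s, ‖𝓕⁻ φ s‖ ≤ D * (1 + ‖s‖) ^ (-(3 : ℕ) : ℝ)) (hf : AEStronglyMeasurable f volume)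
    {R : ℝ} (hR : 0 < R) (α x : ℝ) :
    shiftedSquareFunction φ f R α x ≤
      (ENNReal.ofReal (16 * D) * ∑' n : ℤ, ENNReal.ofReal ((1 + ‖(n : ℝ)‖) ^ (-2 : ℝ))) *
        maximalFunction volume (fun y => ‖f y‖ₑ ^ (2 : ℝ)) x ^ (1 / 2 : ℝ) := by
  have hc : -R⁻¹ ≠ 0 := neg_ne_zero.2 (inv_ne_zero hR.ne')
  set G : ℝ → ℂ := fun s => f (x + (-R⁻¹) • s) * 𝓕⁻ φ s
  have hGm : AEStronglyMeasurable G volume := by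
    refine .mul (hf.comp_quasiMeasurePreserving ?_) hφ.aestronglyMeasurable
    exact (quasiMeasurePreserving_add_left volume x).comp
      (Measure.quasiMeasurePreserving_smul volume hc)
  have hpiece : ∀ j : ℤ, freqPiece φ f (α + j * R) (α + (j + 1) * R) x =
      𝓕⁻ G (α / R + 1 / 2 + j) := fun j => by
    have hlt : α + j * R < α + (j + 1) * R := by linarith
    have hlength : α + (j + 1) * R - (α + j * R) = R := by ring
    have hfreq : (α + j * R + (α + (j + 1) * R)) / 2 / R = α / R + 1 / 2 + j := by
      field_simp
      ring
    rw [freqPiece_apply φ f hlt, hlength, hfreq]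
  calc shiftedSquareFunction φ f R α x
      = (∑' j : ℤ, ‖𝓕⁻ G (α / R + 1 / 2 + j)‖ₑ ^ 2) ^ (1 / 2 : ℝ) := by
        simp only [shiftedSquareFunction, hpiece]
    _ ≤ ∑' n : ℤ, eLpNorm G 2 (volume.restrict (Ioc (n : ℝ) (n + 1))) :=
        rpow_tsum_sq_enorm_fourierInv_le hGm _
    _ ≤ ∑' n : ℤ, ENNReal.ofReal (16 * D) * ENNReal.ofReal ((1 + ‖(n : ℝ)‖) ^ (-2 : ℝ)) *
          maximalFunction volume (fun y => ‖f y‖ₑ ^ (2 : ℝ)) x ^ (1 / 2 : ℝ) :=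
        ENNReal.tsum_le_tsum fun n => eLpNorm_two_comp_add_smul_mul_Ioc_le f hD hφD x hc n
    _ = _ := by rw [ENNReal.tsum_mul_right, ENNReal.tsum_mul_left]

theorem exists_restrictedVariation_le (φ : 𝓢(ℝ, ℂ)) :
    ∃ C : ℝ≥0, ∀ f : ℝ → ℂ, AEStronglyMeasurable f volume → ∀ x,
      restrictedVariation φ f x ≤
        C * maximalFunction volume (fun y => ‖f y‖ₑ ^ (2 : ℝ)) x ^ (1 / 2 : ℝ) := by
  obtain ⟨D, hD, hφD⟩ := exists_norm_schwartzMap_le (𝓕⁻ φ) 3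
  have hφ := (𝓕⁻ φ).continuous
  rw [SchwartzMap.fourierInv_coe] at hφ
  simp only [SchwartzMap.fourierInv_coe] at hφD
  obtain ⟨C, hC⟩ : ∃ C : ℝ≥0, C = ENNReal.ofReal (16 * D) *
      ∑' n : ℤ, ENNReal.ofReal ((1 + ‖(n : ℝ)‖) ^ (-2 : ℝ)) :=
    CanLift.prf _ (ENNReal.mul_ne_top ENNReal.ofReal_ne_top
      tsum_ofReal_one_add_norm_rpow_neg_two_ne_top)
  refine ⟨C, fun f hf x => ?_⟩
  rw [hC]
  exact iSup_le fun R => iSup_le fun hR => iSup_le fun α => iSup_le fun _ =>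
    shiftedSquareFunction_le hφ hD hφD hf hR α x

theorem lowerSemicontinuous_restrictedVariation (φ : 𝓢(ℝ, ℂ)) {f : ℝ → ℂ} {p : ℝ≥0∞}
    (hf : MemLp f p volume) (hp : 1 ≤ p) : LowerSemicontinuous (restrictedVariation φ f) := by
  refine lowerSemicontinuous_iSup fun R => lowerSemicontinuous_iSup fun hR =>
    lowerSemicontinuous_iSup fun α => lowerSemicontinuous_iSup fun _ =>
    ENNReal.continuous_rpow_const.comp_lowerSemicontinuous
      (lowerSemicontinuous_tsum fun j => Continuous.lowerSemicontinuous ?_)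
      (ENNReal.monotone_rpow_of_nonneg (by norm_num))
  obtain ⟨ψ, hψ⟩ := exists_schwartzMap_coe_eq_intervalKernel φ
    (a := α + j * R) (b := α + (j + 1) * R) (by linarith)
  have hcont : Continuous (freqPiece φ f (α + j * R) (α + (j + 1) * R)) := by
    rw [freqPiece, ← hψ]
    exact continuous_convolution_schwartzMap hf hp ψ _
  exact (ENNReal.continuous_pow 2).comp hcont.enorm

end PointwiseBound

theorem mainTheorem5_general (φ : 𝓢(ℝ, ℂ)) (p : ℝ≥0∞) (hp : 2 < p) :
    ∃ C : ℝ≥0, ∀ f : ℝ → ℂ, MemLp f p volume →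
      (∀ a b : ℝ, a < b →
        ConvolutionExists f (intervalKernel φ a b) (ContinuousLinearMap.mul ℂ ℂ) volume) ∧
      MemLp (restrictedVariation φ f) p volume ∧
      eLpNorm (restrictedVariation φ f) p volume ≤ C * eLpNorm f p volume := by
  have hp_one : 1 ≤ p := one_le_two.trans hp.le
  obtain ⟨A, hA⟩ := exists_restrictedVariation_le φ
  obtain ⟨B, hB⟩ := exists_eLpNorm_maximalFunction_enorm_rpow_le (F := ℂ)
    (fun c r => addHaar_ball_mul_le (volume : Measure ℝ) c four_pos r) two_pos (p := p)
    (by simpa using hp)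
  refine ⟨A * B, fun f hf => ?_⟩
  have hbound : eLpNorm (restrictedVariation φ f) p volume ≤ (A * B : ℝ≥0) * eLpNorm f p volume :=
    calc eLpNorm (restrictedVariation φ f) p volume
        ≤ A * eLpNorm (fun x =>
            maximalFunction volume (fun y => ‖f y‖ₑ ^ (2 : ℝ)) x ^ (1 / 2 : ℝ)) p volume :=
          eLpNorm_le_mul_eLpNorm_of_ae_le_mul' (ae_of_all _ (hA f hf.1)) p
      _ ≤ A * (B * eLpNorm f p volume) := by grw [hB f hf.1]
      _ = (A * B : ℝ≥0) * eLpNorm f p volume := by rw [ENNReal.coe_mul, mul_assoc]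
  refine ⟨fun a b hab => ?_, ⟨?_, hbound.trans_lt (ENNReal.mul_lt_top ENNReal.coe_lt_top hf.2)⟩,
    hbound⟩
  · obtain ⟨ψ, hψ⟩ := exists_schwartzMap_coe_eq_intervalKernel φ hab
    exact hψ ▸ convolutionExists_schwartzMap hf hp_one ψ _
  · exact (lowerSemicontinuous_restrictedVariation φ hf hp_one).measurable.aestronglyMeasurable

theorem mainTheorem5 (φ : ℝ → ℂ) (hφ : ContDiff ℝ ∞ φ)
    (hsupp : Function.support φ ⊆ Icc (-1 / 2) (1 / 2))
    (p : ℝ≥0∞) (hp : 2 < p) (hp' : p < ⊤) :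
    ∃ C : ℝ≥0, ∀ f : ℝ → ℂ, MemLp f p volume →
      (∀ a b : ℝ, a < b →
        ConvolutionExists f (intervalKernel φ a b) (ContinuousLinearMap.mul ℂ ℂ) volume) ∧
      MemLp (restrictedVariation φ f) p volume ∧
      eLpNorm (restrictedVariation φ f) p volume ≤ C * eLpNorm f p volume :=
  mainTheorem5_general
    ((HasCompactSupport.of_support_subset_isCompact isCompact_Icc hsupp).toSchwartzMap hφ) p hp
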